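/- All systems are finite-dimensional and non-zero. Let $\mathcal T(A,B)$ be the set of quantum channels (completely positive trace-preserving linear maps) from system $A$ to system $B$, and let $\mathfrak F\subseteq\mathcal T(A,B)$ be the set of constant channels, i.e. channels $\Xi$ for which there is a state $\sigma$ with $\Xi(\rho)=\sigma$ for all states $\rho$. Let $\mathcal S(\{A,B\},\{A',B'\})$ be the set of superchannels: linear maps $\Theta$ from linear maps $A\to B$ to linear maps $A'\to B'$ such that $\Theta[\mathcal N]\in\mathcal T(A',B')$ for every $\mathcal N\in\mathcal T(A,B)$ and such that $\mathrm{id}\otimes\Theta$ sends completely positive maps $RA\to SB$ to completely positive maps $RA'\to SB'$ for all auxiliary systems $R,S$. Fix systems $A_o,B_i,A_i,B_o$ and put $\mathcal S=\mathcal S(\{A_o,B_i\},\{A_i,B_o\})$. Let $$\mathcal O_{\mathfrak F}:=\{\Theta\in\mathcal S \mid \Theta[\Xi]\in\mathfrak F\ \text{ for all } \Xi\in\mathfrak F\}.$$ A channel $\Pi\in\mathcal T(A_iB_i,A_oB_o)$ is called non-signalling if for all states $\rho,\rho^{(0)},\rho^{(1)}$ of $A_i$ and $\tau,\tau^{(0)},\tau^{(1)}$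 of $B_i$ $$\mathrm{Tr}_{A_o}\Pi(\rho^{(0)}\otimes\tau)=\mathrm{Tr}_{A_o}\Pi(\rho^{(1)}\otimes\tau),\qquad \mathrm{Tr}_{B_o}\Pi(\rho\otimes\tau^{(0)})=\mathrm{Tr}_{B_o}\Pi(\rho\otimes\tau^{(1)}).$$ For $\mathcal N\in\mathcal T(A_o,B_i)$ let $\Pi\circ\mathcal N$ be the map $A_i\to B_o$ obtained by feeding the output $A_o$ of $\Pi$ through $\mathcal N$ into the input $B_i$ of $\Pi$ (comb concatenation): with orthonormal bases $\{|a\rangle\}$ of $A_o$ and $\{|i\rangle\}$ of $B_i$, $$(\Pi\circ\mathcal N)(\rho)=\sum_{a,a',i,i'}\langle i|\mathcal N(|a\rangle\langle a'|)|i'\rangle\;\langle a|_{A_o}\,\Pi\big(\rho\otimes|i\rangle\langle i'|\big)\,|a'\rangle_{A_o}.$$ Let $$\mathcal O_{\rm NS}:=\{\Theta\in\mathcal S\mid \exists\,\Pi\in\mathcal T(A_iB_i,A_oB_o)\text{ non-signalling such that } \Theta[\mathcal N]=\Pi\circ\mathcal N\ \text{ for all }\mathcal N\in\mathcal T(A_o,B_i)\}.$$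 Then $\mathcal O_{\mathfrak F}=\mathcal O_{\rm NS}$. -/

import Mathlib

open scoped Kronecker ComplexOrder

namespace QChan

/-- Operators on the finite-dimensional Hilbert space with orthonormal basis `A`. -/
abbrev Op (A : Type*) : Type _ := Matrix A A ℂ

/-- Linear maps from operators on system `A` to operators on system `B`. -/
abbrev OpMap (A B : Type*) : Type _ := Op A →ₗ[ℂ] Op B

/-- Linear maps transforming maps `A → B` into maps `A' → B'`. -/
abbrev SuperMap (A B A' B' : Type*) : Type _ := OpMap A B →ₗ[ℂ] OpMap A' B'

/-- The `(r, r')` block of an operator on `R ⊗ A`. -/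
def block {R A : Type*} (X : Op (R × A)) (r r' : R) : Op A :=
  Matrix.of fun a a' => X (r, a) (r', a')

/-- Partial trace over the left tensor factor. -/
def traceLeft {A B : Type*} [Fintype A] (X : Op (A × B)) : Op B :=
  Matrix.of fun b b' => ∑ a, X (a, b) (a, b')

/-- Partial trace over the right tensor factor. -/
def traceRight {A B : Type*} [Fintype B] (X : Op (A × B)) : Op A :=
  Matrix.of fun a a' => ∑ b, X (a, b) (a', b)

/-- A quantum state (density operator). -/
def IsState {A : Type*} [Fintype A] (ρ : Op A) : Prop :=
  ρ.PosSemidef ∧ ρ.trace = 1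

/-- The map `id_R ⊗ Φ`, acting blockwise by `Φ`. -/
def idTensor (R : Type*) {A B : Type*} (Φ : OpMap A B) : OpMap (R × A) (R × B) where
  toFun X := Matrix.of fun p q => Φ (block X p.1 q.1) p.2 q.2
  map_add' X Y := by
    ext p q
    have h : block (X + Y) p.1 q.1 = block X p.1 q.1 + block Y p.1 q.1 := rfl
    simp [h]
  map_smul' c X := by
    ext p q
    have h : block (c • X) p.1 q.1 = c • block X p.1 q.1 := rfl
    simp [h]

/-- Complete positivity: `id_k ⊗ Φ` preserves positive semidefiniteness for every `k`. -/
def IsCP {A B : Type*} (Φ : OpMap A B) : Prop :=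
  ∀ (k : ℕ) (X : Op (Fin k × A)), X.PosSemidef → (idTensor (Fin k) Φ X).PosSemidef

/-- Trace preservation. -/
def IsTP {A B : Type*} [Fintype A] [Fintype B] (Φ : OpMap A B) : Prop :=
  ∀ X : Op A, (Φ X).trace = X.trace

/-- The set `𝒯(A, B)` of quantum channels: completely positive trace-preserving maps. -/
def channels (A B : Type*) [Fintype A] [Fintype B] : Set (OpMap A B) :=
  {Φ | IsCP Φ ∧ IsTP Φ}

/-- The set `𝔉` of constant channels: those which send every state to one fixed state. -/
def constantChannels (A B : Type*) [Fintype A] [Fintype B] : Set (OpMap A B) :=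
  {Φ | Φ ∈ channels A B ∧ ∃ σ : Op B, IsState σ ∧ ∀ ρ : Op A, IsState ρ → Φ ρ = σ}

/-- For `M : R ⊗ A → S ⊗ B`, the map `A → B` given by
`X ↦ (⟨s| ⊗ 1) M(|r⟩⟨r'| ⊗ X) (|s'⟩ ⊗ 1)`. -/
def blockMap {R A S B : Type*} [DecidableEq R] (M : OpMap (R × A) (S × B))
    (r r' : R) (s s' : S) : OpMap A B where
  toFun X := block (M (Matrix.single r r' 1 ⊗ₖ X)) s s'
  map_add' X Y := by
    rw [Matrix.kronecker_add, map_add]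
    rfl
  map_smul' c X := by
    rw [Matrix.kronecker_smul, map_smul]
    rfl

/-- The supermap `id ⊗ Θ`, where the identity acts on maps `R → S`: it sends a map
`M : R ⊗ A → S ⊗ B` to the map `R ⊗ A' → S ⊗ B'` obtained by applying `Θ` to every
block `blockMap M r r' s s' : A → B`. -/
def superTensor {R S A B A' B' : Type*} [Fintype R] [DecidableEq R]
    (Θ : SuperMap A B A' B') (M : OpMap (R × A) (S × B)) : OpMap (R × A') (S × B') where
  toFun X := Matrix.of fun p q =>
    ∑ r, ∑ r', Θ (blockMap M r r' p.1 q.1) (block X r r') p.2 q.2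
  map_add' X Y := by
    ext p q
    have h : ∀ r r', block (X + Y) r r' = block X r r' + block Y r r' := fun _ _ => rfl
    simp [h, Finset.sum_add_distrib]
  map_smul' c X := by
    ext p q
    have h : ∀ r r', block (c • X) r r' = c • block X r r' := fun _ _ => rfl
    simp [h, Finset.mul_sum]

/-- The set `𝒮({A, B}, {A', B'})` of superchannels: linear supermaps `Θ` which map channels to
channels and are completely CP-preserving, i.e. `id ⊗ Θ` maps completely positive maps to
completely positive maps, for all auxiliary input and output systems. -/
def superchannels (A B A' B' : Type*) [Fintype A] [Fintype B] [Fintype A'] [Fintype B'] :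
    Set (SuperMap A B A' B') :=
  {Θ | (∀ N ∈ channels A B, Θ N ∈ channels A' B') ∧
    ∀ (k l : ℕ) (M : OpMap (Fin k × A) (Fin l × B)), IsCP M → IsCP (superTensor Θ M)}

/-- The set `𝒪_𝔉` of resource non-generating superchannels: those which map constant channels
to constant channels. -/
def freeSuperchannels (A B A' B' : Type*) [Fintype A] [Fintype B] [Fintype A'] [Fintype B'] :
    Set (SuperMap A B A' B') :=
  {Θ | Θ ∈ superchannels A B A' B' ∧
    ∀ Ξ ∈ constantChannels A B, Θ Ξ ∈ constantChannels A' B'}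

/-- A bipartite channel `Π : Aᵢ Bᵢ → Aₒ Bₒ` is non-signalling in both directions. -/
def IsNonSignalling {Ai Bi Ao Bo : Type*} [Fintype Ai] [Fintype Bi] [Fintype Ao] [Fintype Bo]
    (P : OpMap (Ai × Bi) (Ao × Bo)) : Prop :=
  (∀ (ρ₀ ρ₁ : Op Ai) (τ : Op Bi), IsState ρ₀ → IsState ρ₁ → IsState τ →
    traceLeft (P (ρ₀ ⊗ₖ τ)) = traceLeft (P (ρ₁ ⊗ₖ τ))) ∧
  (∀ (ρ : Op Ai) (τ₀ τ₁ : Op Bi), IsState ρ → IsState τ₀ → IsState τ₁ →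
    traceRight (P (ρ ⊗ₖ τ₀)) = traceRight (P (ρ ⊗ₖ τ₁)))

/-- The concatenation `Π ∘ N : Aᵢ → Bₒ` of a bipartite map `Π : Aᵢ Bᵢ → Aₒ Bₒ` with a map
`N : Aₒ → Bᵢ`, in which the output `Aₒ` of `Π` is sent through `N` into the input `Bᵢ` of `Π`.
In matrix elements,
`(Π ∘ N)(ρ) = ∑ ⟨i| N(|a⟩⟨a'|) |i'⟩ ⟨a| Π(ρ ⊗ |i⟩⟨i'|) |a'⟩`. -/
def plug {Ai Bi Ao Bo : Type*} [Fintype Bi] [Fintype Ao] [DecidableEq Bi] [DecidableEq Ao]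
    (P : OpMap (Ai × Bi) (Ao × Bo)) (N : OpMap Ao Bi) : OpMap Ai Bo where
  toFun ρ := ∑ a, ∑ a', ∑ i, ∑ i',
    N (Matrix.single a a' 1) i i' • block (P (ρ ⊗ₖ Matrix.single i i' 1)) a a'
  map_add' X Y := by
    have h : ∀ (Z W : Op (Ao × Bo)) (a a' : Ao),
      block (Z + W) a a' = block Z a a' + block W a a' := fun _ _ _ _ => rfl
    simp [Matrix.add_kronecker, h, Finset.sum_add_distrib]
  map_smul' c X := by
    have h : ∀ (Z : Op (Ao × Bo)) (a a' : Ao),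
      block (c • Z) a a' = c • block Z a a' := fun _ _ _ => rfl
    simp [Matrix.smul_kronecker, h, Finset.smul_sum, smul_comm c]

/-- If `Π` is a comb, consisting of a first tooth `pre : Aᵢ → E Aₒ`, a memory `E` and a second
tooth `post : E Bᵢ → Bₒ`, then `Π ∘ N = post ∘ (id_E ⊗ N) ∘ pre`. -/
theorem plug_eq_of_comb {Ai Bi Ao Bo E : Type*} [Fintype Bi] [Fintype Ao]
    [DecidableEq Bi] [DecidableEq Ao] (P : OpMap (Ai × Bi) (Ao × Bo))
    (pre : OpMap Ai (E × Ao)) (post : OpMap (E × Bi) Bo)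
    (hP : ∀ (ρ : Op Ai) (τ : Op Bi), P (ρ ⊗ₖ τ) = idTensor Ao post
      (Matrix.of fun p q => pre ρ (p.2.1, p.1) (q.2.1, q.1) * τ p.2.2 q.2.2))
    (N : OpMap Ao Bi) : plug P N = post ∘ₗ idTensor E N ∘ₗ pre := by
  ext1 ρ
  have hb : ∀ a a' i i', block (P (ρ ⊗ₖ Matrix.single i i' 1)) a a' =
      post (Matrix.of fun p q : E × Bi => pre ρ (p.1, a) (q.1, a') *
        (Matrix.single i i' 1 : Op Bi) p.2 q.2) := by
    intro a a' i i'
    rw [hP]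
    rfl
  have hN : ∀ X : Op Ao, N X = ∑ a, ∑ a', X a a' • N (Matrix.single a a' 1) := by
    intro X
    conv_lhs => rw [Matrix.matrix_eq_sum_single X]
    simp only [map_sum]
    refine Finset.sum_congr rfl fun a _ => Finset.sum_congr rfl fun a' _ => ?_
    rw [← map_smul, Matrix.smul_single, smul_eq_mul, mul_one]
  change ∑ a, ∑ a', ∑ i, ∑ i',
    N (Matrix.single a a' 1) i i' • block (P (ρ ⊗ₖ Matrix.single i i' 1)) a a' =
      post (idTensor E N (pre ρ))
  simp only [hb, ← map_smul, ← map_sum]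
  congr 1
  ext p q
  change _ = N (block (pre ρ) p.1 q.1) p.2 q.2
  rw [hN]
  simp only [Matrix.sum_apply, Matrix.smul_apply, Matrix.of_apply, Matrix.single_apply, block,
    smul_eq_mul]
  refine Finset.sum_congr rfl fun a _ => Finset.sum_congr rfl fun a' _ => ?_
  rw [Finset.sum_eq_single p.2, Finset.sum_eq_single q.2]
  · simp [mul_comm]
  · intro i' _ h
    simp [h]
  · simp
  · intro i _ h
    simp [h]
  · simp

/-- The set `𝒪_NS` of superchannels realized by non-signalling bipartite channels. -/
def nonSignallingSuperchannels (Ao Bi Ai Bo : Type*) [Fintype Ao] [Fintype Bi] [Fintype Ai]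
    [Fintype Bo] [DecidableEq Ao] [DecidableEq Bi] : Set (SuperMap Ao Bi Ai Bo) :=
  {Θ | Θ ∈ superchannels Ao Bi Ai Bo ∧
    ∃ P ∈ channels (Ai × Bi) (Ao × Bo), IsNonSignalling P ∧
      ∀ N ∈ channels Ao Bi, Θ N = plug P N}

end QChan

/-!
A supermap `Θ` is encoded by a bipartite map `combOf Θ`, defined by
`⟨a| P(ρ ⊗ |i⟩⟨i'|) |a'⟩ = Θ[X ↦ ⟨a| X |a'⟩ |i⟩⟨i'|](ρ)`. Since the maps in the bracket span all
linear maps, `Θ[N] = combOf Θ ∘ N` for every `N` (`plug_combOf`), and for every superchannel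
`combOf Θ` is a channel (`isCP_combOf`, `isTP_combOf`).

Its two partial traces have direct meanings. Tracing out `Aₒ` gives
`Θ[X ↦ Tr(X) τ](ρ)`, the value of `Θ` on a constant channel (`traceLeft_combOf_kronecker`); so there
is no signalling from `Aᵢ` to `Bₒ` when `Θ` preserves constant channels. Tracing out `Bₒ` gives the
traces of `Θ[X ↦ Tr(M X) τ](ρ)` for the matrix units `M`. These never depend on the state `τ`: for
a pure state `M`, the channels `X ↦ Tr(M X) τ + Tr((1 - M) X) τ₁` differ only in the first summand
as `τ` varies, and their images under `Θ` preserve the trace; pure states span by polarization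
(`trace_measPrep_eq`, `linearMap_ext_of_isPureState`).

Conversely, if `Θ[N] = P ∘ N` on channels, then `Θ` takes the constant channel with value `σ` to
`ρ ↦ Tr_{Aₒ} P(ρ ⊗ σ)` (`plug_measPrep_one`), which is constant on states when `P` is
non-signalling.
-/

namespace QChan

/-! ### Pure states span the operators -/

section Spanning

variable {A W : Type*} [Fintype A]

/-- A pure state: a state which is an orthogonal projection. -/
def IsPureState (Q : Op A) : Prop :=
  IsState Q ∧ Q * Q = Q

theorem isPureState_smul_vecMulVec (v : A → ℂ) (hv : v ≠ 0) :
    IsPureState ((v ⬝ᵥ star v)⁻¹ • Matrix.vecMulVec v (star v)) := by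
  have h0 : v ⬝ᵥ star v ≠ 0 := by simpa using hv
  have hpos : 0 ≤ v ⬝ᵥ star v := dotProduct_comm v (star v) ▸ dotProduct_star_self_nonneg v
  refine ⟨⟨(Matrix.posSemidef_vecMulVec_self_star v).smul ?_, ?_⟩, ?_⟩
  · exact inv_nonneg_of_nonneg hpos
  · simp [Matrix.trace_vecMulVec, h0]
  · simp only [Matrix.smul_mul, Matrix.mul_smul, Matrix.vecMulVec_mul_vecMulVec]
    rw [dotProduct_comm (star v) v, smul_smul, Matrix.vecMulVec_smul, smul_smul, mul_assoc,
      inv_mul_cancel₀ h0, mul_one]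

/-- Pure states span the space of operators, by polarization of `|v⟩⟨v|`. -/
theorem linearMap_ext_of_isPureState [DecidableEq A] [AddCommGroup W] [Module ℂ W]
    {f g : Op A →ₗ[ℂ] W} (h : ∀ Q, IsPureState Q → f Q = g Q) : f = g := by
  have hv : ∀ v : A → ℂ, (f - g) (Matrix.vecMulVec v (star v)) = 0 := by
    intro v
    by_cases hv : v = 0
    · simp [hv]
    · have h0 : v ⬝ᵥ star v ≠ 0 := by simpa using hv
      have h1 := h _ (isPureState_smul_vecMulVec v hv)
      rw [← sub_eq_zero, ← LinearMap.sub_apply, map_smul] at h1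
      exact (smul_eq_zero.mp h1).resolve_left (inv_ne_zero h0)
  rw [← sub_eq_zero]
  refine Matrix.ext_linearMap _ fun a b => LinearMap.ext_ring ?_
  have e : ∀ x y : A, Matrix.vecMulVec (Pi.single x (1 : ℂ)) (Pi.single y 1) =
      Matrix.single x y 1 := fun x y => by simp [Matrix.single_eq_single_vecMulVec_single]
  have hs : ∀ (x : A) (c : ℂ), star (Pi.single x c : A → ℂ) = Pi.single x (star c) :=
    fun x c => by
      ext y; simp [Pi.single_apply, apply_ite star]
  have ha := hv (Pi.single a 1)
  have hb := hv (Pi.single b 1)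
  have hr := hv (Pi.single a 1 + Pi.single b 1)
  have hc := hv (Pi.single a 1 + Complex.I • Pi.single b 1)
  simp only [star_add, star_smul, hs, star_one, Matrix.add_vecMulVec, Matrix.vecMulVec_add,
    Matrix.smul_vecMulVec, Matrix.vecMulVec_smul, e, map_add, map_smul] at ha hb hr hc
  simp only [ha, hb, zero_add, add_zero, smul_zero] at hr hc
  have h2 : (f - g) (Matrix.single b a 1) = -(f - g) (Matrix.single a b 1) :=
    eq_neg_of_add_eq_zero_left (by simpa [add_comm] using hr)
  rw [h2, Complex.star_def, Complex.conj_I, neg_smul, smul_neg, ← neg_add, neg_eq_zero,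
    ← two_smul ℂ, smul_smul] at hc
  simpa using (smul_eq_zero.mp hc).resolve_left (by simp)

theorem linearMap_ext_of_isState [DecidableEq A] [AddCommGroup W] [Module ℂ W]
    {f g : Op A →ₗ[ℂ] W} (h : ∀ ρ, IsState ρ → f ρ = g ρ) : f = g :=
  linearMap_ext_of_isPureState fun Q hQ => h Q hQ.1

theorem exists_isState [Nonempty A] : ∃ ρ : Op A, IsState ρ := by
  obtain ⟨a⟩ := ‹Nonempty A›
  classical
  exact ⟨_, (isPureState_smul_vecMulVec (Pi.single a (1 : ℂ)) (by simp)).1⟩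

/-- A pure state is a Gram operator of itself, and so is its complementary projection. -/
theorem IsPureState.gram {Q : Op A} [DecidableEq A] (hQ : IsPureState Q) :
    Q = Q.conjTranspose * Q ∧ 1 - Q = (1 - Q).conjTranspose * (1 - Q) := by
  have h := hQ.1.1.isHermitian.eq
  refine ⟨by rw [h, hQ.2], ?_⟩
  rw [Matrix.conjTranspose_sub, h, Matrix.conjTranspose_one, mul_sub, sub_mul, sub_mul, hQ.2]
  simp

end Spanning

/-! ### Measure-and-prepare maps -/

section Channels

variable {A B : Type*}

theorem IsCP.add {Φ Ψ : OpMap A B} (hΦ : IsCP Φ) (hΨ : IsCP Ψ) : IsCP (Φ + Ψ) := by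
  intro k X hX
  have h : idTensor (Fin k) (Φ + Ψ) X = idTensor (Fin k) Φ X + idTensor (Fin k) Ψ X := rfl
  rw [h]
  exact (hΦ k X hX).add (hΨ k X hX)

theorem IsCP.posSemidef {Φ : OpMap A B} (hΦ : IsCP Φ) {X : Op A} (hX : X.PosSemidef) :
    (Φ X).PosSemidef :=
  (hΦ 1 (X.submatrix Prod.snd Prod.snd) (hX.submatrix _)).submatrix fun b => (0, b)

theorem isState_of_mem_channels [Fintype A] [Fintype B] {Φ : OpMap A B} (hΦ : Φ ∈ channels A B)
    {ρ : Op A} (hρ : IsState ρ) : IsState (Φ ρ) :=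
  ⟨hΦ.1.posSemidef hρ.1, (hΦ.2 ρ).trans hρ.2⟩

variable [Fintype A]

/-- The map `X ↦ Tr(M X) Y`, as a bilinear function of `M` and `Y`. For an effect `M` and a state
`Y` it is one branch of a measure-and-prepare channel. -/
def measPrep : Op A →ₗ[ℂ] Op B →ₗ[ℂ] OpMap A B :=
  LinearMap.mk₂ ℂ
    (fun M Y => ((Matrix.traceLinearMap A ℂ ℂ) ∘ₗ LinearMap.mulLeft ℂ M).smulRight Y)
    (fun M N Y => by ext1 X; simp [add_mul, add_smul])
    (fun c M Y => by ext1 X; simp [mul_smul])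
    (fun M Y Z => by ext1 X; simp)
    (fun c M Y => by ext1 X; simp [smul_comm c])

@[simp]
theorem measPrep_apply (M : Op A) (Y : Op B) (X : Op A) :
    measPrep M Y X = (M * X).trace • Y := rfl

open scoped Matrix in
theorem isCP_measPrep (C : Op A) {Y : Op B} [Finite B] (hY : Y.PosSemidef) :
    IsCP (measPrep (Cᴴ * C) Y) := by
  classical
  intro k X hX
  -- Row `j` of `C`, extended by the identity on the auxiliary system.
  let K : A → Matrix (Fin k) (Fin k × A) ℂ := fun j =>
    Matrix.of fun r p => if r = p.1 then C j p.2 else 0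
  have h : idTensor (Fin k) (measPrep (Cᴴ * C) Y) X = (∑ j, K j * X * (K j)ᴴ) ⊗ₖ Y := by
    ext ⟨r, b⟩ ⟨r', b'⟩
    change (Cᴴ * C * block X r r').trace * Y b b' = (∑ j, K j * X * (K j)ᴴ) r r' * Y b b'
    congr 1
    rw [mul_assoc, Matrix.trace_mul_comm, Matrix.sum_apply]
    refine Finset.sum_congr rfl fun j _ => ?_
    simp [K, Matrix.mul_apply, Fintype.sum_prod_type, ite_mul, apply_ite star,
      Finset.sum_ite_irrel, block]
  rw [h]
  exact (Matrix.posSemidef_sum _ fun j _ => hX.mul_mul_conjTranspose_same (K j)).kronecker hY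

/-- The measure-and-prepare channel which measures `{Q, 1 - Q}` and prepares `σ` or `τ`. -/
theorem measPrep_add_mem_channels [DecidableEq A] [Fintype B] {Q : Op A} {σ τ : Op B}
    (hQ : IsPureState Q) (hσ : IsState σ) (hτ : IsState τ) :
    measPrep Q σ + measPrep (1 - Q) τ ∈ channels A B := by
  refine ⟨?_, fun X => ?_⟩
  · have h := (isCP_measPrep Q hσ.1).add (isCP_measPrep (1 - Q) hτ.1)
    rwa [← hQ.gram.1, ← hQ.gram.2] at h
  · simp [hσ.2, hτ.2]

theorem measPrep_one_mem_constantChannels [DecidableEq A] [Fintype B] {σ : Op B}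
    (hσ : IsState σ) : measPrep (1 : Op A) σ ∈ constantChannels A B := by
  refine ⟨⟨?_, fun X => by simp [hσ.2]⟩, σ, hσ, fun ρ hρ => by simp [hρ.2]⟩
  simpa using isCP_measPrep (1 : Op A) hσ.1

theorem exists_eq_measPrep_one_of_mem_constantChannels [DecidableEq A] [Fintype B] {Ξ : OpMap A B}
    (hΞ : Ξ ∈ constantChannels A B) : ∃ σ, IsState σ ∧ Ξ = measPrep 1 σ := by
  obtain ⟨-, σ, hσ, h⟩ := hΞ
  refine ⟨σ, hσ, linearMap_ext_of_isState fun ρ hρ => ?_⟩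
  simp [h ρ hρ, hρ.2]

/-- The maps `X ↦ ⟨a| X |a'⟩ |i⟩⟨i'|` span all linear maps. -/
theorem eq_sum_measPrep [DecidableEq A] [Fintype B] [DecidableEq B] (N : OpMap A B) :
    N = ∑ a, ∑ a', ∑ i, ∑ i', N (Matrix.single a a' 1) i i' •
      measPrep (Matrix.single a' a 1) (Matrix.single i i' 1) := by
  refine Matrix.ext_linearMap _ fun b b' => LinearMap.ext_ring ?_
  ext j j'
  simp only [LinearMap.comp_apply, LinearMap.sum_apply, LinearMap.smul_apply,
    Matrix.singleLinearMap_apply, measPrep_apply, Matrix.sum_apply, Matrix.smul_apply]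
  have h : ∀ a a', (Matrix.single a' a (1 : ℂ) * Matrix.single b b' 1).trace =
      if b = a ∧ b' = a' then 1 else 0 := by
    intro a a'
    simp [Matrix.trace_single_mul, Matrix.single_apply]
  simp [h, Matrix.single_apply, ite_and]

end Channels

/-! ### The bipartite map of a supermap -/

section Comb

variable {Ao Bi Ai Bo : Type*} [Fintype Ao] [DecidableEq Ao] [Fintype Bi] [DecidableEq Bi]

/-- The bipartite map `Aᵢ Bᵢ → Aₒ Bₒ` of a supermap `Θ`, whose Choi operator is that of `Θ`. It is
determined by `⟨a| P(ρ ⊗ |i⟩⟨i'|) |a'⟩ = Θ[X ↦ ⟨a| X |a'⟩ |i⟩⟨i'|](ρ)`. -/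
def combOf (Θ : SuperMap Ao Bi Ai Bo) : OpMap (Ai × Bi) (Ao × Bo) where
  toFun X := Matrix.of fun p q => ∑ i, ∑ i',
    Θ (measPrep (Matrix.single q.1 p.1 1) (Matrix.single i i' 1))
      (X.submatrix (·, i) (·, i')) p.2 q.2
  map_add' X Y := by
    ext p q
    simp [Matrix.submatrix_add, Finset.sum_add_distrib]
  map_smul' c X := by
    ext p q
    simp [Matrix.submatrix_smul, Finset.mul_sum]

theorem block_combOf_kronecker (Θ : SuperMap Ao Bi Ai Bo) (ρ : Op Ai) (τ : Op Bi) (a a' : Ao) :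
    block (combOf Θ (ρ ⊗ₖ τ)) a a' = Θ (measPrep (Matrix.single a' a 1) τ) ρ := by
  have h : ∀ i i', (ρ ⊗ₖ τ).submatrix (·, i) (·, i') = τ i i' • ρ :=
    fun i i' => by ext x y; simp [mul_comm]
  have hτ : τ = ∑ i, ∑ i', τ i i' • Matrix.single i i' (1 : ℂ) := by
    conv_lhs => rw [Matrix.matrix_eq_sum_single τ]
    simp [Matrix.smul_single]
  conv_rhs => rw [hτ]
  ext b b'
  simp only [map_sum, map_smul, LinearMap.sum_apply, LinearMap.smul_apply, Matrix.sum_apply]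
  simp only [block, combOf, LinearMap.coe_mk, AddHom.coe_mk, Matrix.of_apply, h, map_smul]

/-- The concatenation with `combOf Θ` reproduces `Θ` on all linear maps, not only on channels. -/
theorem plug_combOf (Θ : SuperMap Ao Bi Ai Bo) (N : OpMap Ao Bi) : plug (combOf Θ) N = Θ N := by
  conv_rhs => rw [eq_sum_measPrep N]
  ext1 ρ
  simp only [map_sum, map_smul, LinearMap.sum_apply, LinearMap.smul_apply]
  simp only [plug, LinearMap.coe_mk, AddHom.coe_mk, block_combOf_kronecker]

theorem traceLeft_eq_sum_block {A B : Type*} [Fintype A] (X : Op (A × B)) :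
    traceLeft X = ∑ a, block X a a := by
  ext b b'
  simp [traceLeft, block, Matrix.sum_apply]

theorem traceLeft_combOf_kronecker (Θ : SuperMap Ao Bi Ai Bo) (ρ : Op Ai) (τ : Op Bi) :
    traceLeft (combOf Θ (ρ ⊗ₖ τ)) = Θ (measPrep 1 τ) ρ := by
  rw [traceLeft_eq_sum_block, ← Matrix.sum_single_one]
  simp [block_combOf_kronecker, LinearMap.sum_apply]

theorem plug_measPrep_one (P : OpMap (Ai × Bi) (Ao × Bo)) (σ : Op Bi) (ρ : Op Ai) :
    plug P (measPrep 1 σ) ρ = traceLeft (P (ρ ⊗ₖ σ)) := by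
  have hσ : ρ ⊗ₖ σ = ∑ i, ∑ i', σ i i' • (ρ ⊗ₖ Matrix.single i i' (1 : ℂ)) := by
    ext p q
    simp [Matrix.sum_apply, Matrix.single_apply, ite_and, mul_comm]
  have hN : ∀ a a', measPrep (1 : Op Ao) σ (Matrix.single a a' 1) = if a = a' then σ else 0 := by
    intro a a'
    split_ifs with h
    · simp [h]
    · simp [Matrix.trace_single_eq_of_ne a a' (1 : ℂ) h]
  rw [hσ]
  ext b b'
  simp only [map_sum, map_smul, plug, LinearMap.coe_mk, AddHom.coe_mk, hN, Matrix.sum_apply,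
    Matrix.smul_apply, traceLeft, block, Matrix.of_apply]
  refine Finset.sum_congr rfl fun a _ => ?_
  rw [Finset.sum_eq_single a (fun a' _ h => by simp [h.symm]) (by simp)]
  simp

theorem trace_combOf_kronecker [Fintype Bo] (Θ : SuperMap Ao Bi Ai Bo) (ρ : Op Ai) (τ : Op Bi) :
    (combOf Θ (ρ ⊗ₖ τ)).trace = (Θ (measPrep 1 τ) ρ).trace := by
  rw [← traceLeft_combOf_kronecker]
  simp only [Matrix.trace, Matrix.diag_apply, Fintype.sum_prod_type, traceLeft, Matrix.of_apply]
  exact Finset.sum_comm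

theorem traceRight_combOf_kronecker [Fintype Bo] (Θ : SuperMap Ao Bi Ai Bo) (ρ : Op Ai)
    (τ : Op Bi) (a a' : Ao) : traceRight (combOf Θ (ρ ⊗ₖ τ)) a a' =
      (Θ (measPrep (Matrix.single a' a 1) τ) ρ).trace := by
  rw [← block_combOf_kronecker]
  rfl

end Comb

/-! ### Superchannels and non-signalling channels -/

section Superchannels

variable {Ao Bi Ai Bo : Type*} [Fintype Ao] [DecidableEq Ao] [Fintype Bi] [Fintype Ai] [Fintype Bo]

/-- The trace of `Θ[X ↦ Tr(M X) τ](ρ)` does not depend on the state `τ`: for a pure state `M` the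
measure-and-prepare channels with outcome pairs `(τ₀, τ₁)` and `(τ₁, τ₁)` differ only in that
summand, and `Θ` maps both to trace-preserving maps; pure states span. -/
theorem trace_measPrep_eq {Θ : SuperMap Ao Bi Ai Bo} (hΘ : Θ ∈ superchannels Ao Bi Ai Bo)
    {τ₀ τ₁ : Op Bi} (h₀ : IsState τ₀) (h₁ : IsState τ₁) (M : Op Ao) (ρ : Op Ai) :
    (Θ (measPrep M τ₀) ρ).trace = (Θ (measPrep M τ₁) ρ).trace := by
  let F (τ : Op Bi) : Op Ao →ₗ[ℂ] ℂ :=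
    Matrix.traceLinearMap Bo ℂ ℂ ∘ₗ LinearMap.applyₗ ρ ∘ₗ Θ ∘ₗ measPrep.flip τ
  have h : F τ₀ = F τ₁ := by
    refine linearMap_ext_of_isPureState fun Q hQ => ?_
    have e₀ := (hΘ.1 _ (measPrep_add_mem_channels hQ h₀ h₁)).2 ρ
    have e₁ := (hΘ.1 _ (measPrep_add_mem_channels hQ h₁ h₁)).2 ρ
    rw [← e₁, map_add, map_add, LinearMap.add_apply, LinearMap.add_apply, Matrix.trace_add,
      Matrix.trace_add] at e₀
    exact add_right_cancel e₀
  exact LinearMap.congr_fun h M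

variable [DecidableEq Bi]

/-- The map sending `X` to the operator with entries `⟨p| X' |q⟩ = ⟨f p| X |f q⟩`; for a bijection
`f` it renames basis vectors. -/
def relabel {A B : Type*} (f : B → A) : OpMap A B where
  toFun X := X.submatrix f f
  map_add' _ _ := rfl
  map_smul' _ _ := rfl

theorem relabel_apply {A B : Type*} (f : B → A) (X : Op A) (p q : B) :
    relabel f X p q = X (f p) (f q) := rfl

theorem isCP_relabel {A B : Type*} (f : B → A) : IsCP (relabel f) :=
  fun _ _ hX => hX.submatrix (Prod.map id f)

/-- `combOf Θ` is, up to reordering tensor factors, the image under `id ⊗ Θ` of the swap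
`Bᵢ ⊗ Aₒ → Aₒ ⊗ Bᵢ`, whose blocks are the maps `X ↦ ⟨a| X |a'⟩ |i⟩⟨i'|`. -/
theorem isCP_combOf {Θ : SuperMap Ao Bi Ai Bo} (hΘ : Θ ∈ superchannels Ao Bi Ai Bo) :
    IsCP (combOf Θ) := by
  intro n X hX
  -- Complete CP-preservation quantifies over auxiliary systems `Fin k`, hence the relabelling.
  let e := Fintype.equivFin Bi
  let f := Fintype.equivFin Ao
  let S : OpMap (Fin (Fintype.card Bi) × Ao) (Fin (Fintype.card Ao) × Bi) :=
    relabel fun p => (e p.2, f.symm p.1)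
  have hS : ∀ i i' a a', blockMap S (e i) (e i') (f a) (f a') =
      measPrep (Matrix.single a' a 1) (Matrix.single i i' 1) := by
    intro i i' a a'
    ext X j j'
    simp [blockMap, block, S, relabel_apply, Matrix.single_apply, Matrix.trace_single_mul, mul_comm]
  have h := hΘ.2 _ _ S (isCP_relabel _) n
    (X.submatrix (fun p => (p.1, p.2.2, e.symm p.2.1)) (fun p => (p.1, p.2.2, e.symm p.2.1)))
    (hX.submatrix _)
  convert h.submatrix fun p : Fin n × Ao × Bo => (p.1, f p.2.1, p.2.2) using 1
  ext p q
  change ∑ i, ∑ i', Θ _ _ p.2.2 q.2.2 = ∑ r, ∑ r', Θ (blockMap S r r' (f p.2.1) (f q.2.1)) _ _ _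
  rw [← e.sum_comp]
  refine Finset.sum_congr rfl fun i _ => ?_
  rw [← e.sum_comp]
  refine Finset.sum_congr rfl fun i' _ => ?_
  rw [hS]
  refine congrArg (fun Y : Op Ai => Θ _ Y p.2.2 q.2.2)
    (?_ : (block X p.1 q.1).submatrix (·, i) (·, i') = _)
  ext x y
  simp [block]

/-- On `ρ ⊗ τ` with `τ` a state, the trace of `combOf Θ` is that of `Θ[X ↦ Tr(X) τ](ρ)`, and `Θ`
preserves channels; such products span. -/
theorem isTP_combOf {Θ : SuperMap Ao Bi Ai Bo} (hΘ : Θ ∈ superchannels Ao Bi Ai Bo) :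
    IsTP (combOf Θ) := by
  classical
  have h : ∀ (ρ : Op Ai) (τ : Op Bi), (combOf Θ (ρ ⊗ₖ τ)).trace = (ρ ⊗ₖ τ).trace := by
    intro ρ τ
    rw [trace_combOf_kronecker, Matrix.trace_kronecker]
    have key : Matrix.traceLinearMap Bo ℂ ℂ ∘ₗ LinearMap.applyₗ ρ ∘ₗ Θ ∘ₗ measPrep 1 =
        ρ.trace • Matrix.traceLinearMap Bi ℂ ℂ := by
      refine linearMap_ext_of_isState fun τ hτ => ?_
      simpa [hτ.2] using (hΘ.1 _ (measPrep_one_mem_constantChannels hτ).1).2 ρ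
    exact LinearMap.congr_fun key τ
  have key : Matrix.traceLinearMap (Ao × Bo) ℂ ℂ ∘ₗ combOf Θ =
      Matrix.traceLinearMap (Ai × Bi) ℂ ℂ := by
    refine Matrix.ext_linearMap _ fun p q => LinearMap.ext_ring ?_
    have := h (Matrix.single p.1 q.1 1) (Matrix.single p.2 q.2 1)
    simpa [Matrix.single_kronecker_single] using this
  exact fun X => LinearMap.congr_fun key X

theorem isNonSignalling_combOf {Θ : SuperMap Ao Bi Ai Bo}
    (hΘ : Θ ∈ freeSuperchannels Ao Bi Ai Bo) : IsNonSignalling (combOf Θ) := by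
  refine ⟨fun ρ₀ ρ₁ τ h₀ h₁ hτ => ?_, fun ρ τ₀ τ₁ _ h₀ h₁ => ?_⟩
  · obtain ⟨-, σ, -, h⟩ := hΘ.2 _ (measPrep_one_mem_constantChannels hτ)
    rw [traceLeft_combOf_kronecker, traceLeft_combOf_kronecker, h _ h₀, h _ h₁]
  · ext a a'
    rw [traceRight_combOf_kronecker, traceRight_combOf_kronecker, trace_measPrep_eq hΘ.1 h₀ h₁]

theorem mem_constantChannels_of_isNonSignalling [Nonempty Ai] {Θ : SuperMap Ao Bi Ai Bo}
    (hΘ : Θ ∈ superchannels Ao Bi Ai Bo) {P : OpMap (Ai × Bi) (Ao × Bo)} (hP : IsNonSignalling P)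
    (h : ∀ N ∈ channels Ao Bi, Θ N = plug P N) {Ξ : OpMap Ao Bi}
    (hΞ : Ξ ∈ constantChannels Ao Bi) : Θ Ξ ∈ constantChannels Ai Bo := by
  have hc := hΘ.1 Ξ hΞ.1
  obtain ⟨ρ₀, h₀⟩ := exists_isState (A := Ai)
  refine ⟨hc, Θ Ξ ρ₀, isState_of_mem_channels hc h₀, fun ρ hρ => ?_⟩
  rw [h Ξ hΞ.1]
  obtain ⟨σ, hσ, rfl⟩ := exists_eq_measPrep_one_of_mem_constantChannels hΞ
  rw [plug_measPrep_one, plug_measPrep_one]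
  exact hP.1 ρ ρ₀ σ hρ h₀ hσ

end Superchannels

end QChan

theorem mainTheorem3 {Ao Bi Ai Bo : Type*}
    [Fintype Ao] [DecidableEq Ao] [Nonempty Ao] [Fintype Bi] [DecidableEq Bi] [Nonempty Bi]
    [Fintype Ai] [Nonempty Ai] [Fintype Bo] [Nonempty Bo] :
    QChan.freeSuperchannels Ao Bi Ai Bo = QChan.nonSignallingSuperchannels Ao Bi Ai Bo := by
  ext Θ
  constructor
  · intro hΘ
    exact ⟨hΘ.1, QChan.combOf Θ, ⟨QChan.isCP_combOf hΘ.1, QChan.isTP_combOf hΘ.1⟩,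
      QChan.isNonSignalling_combOf hΘ, fun N _ => (QChan.plug_combOf Θ N).symm⟩
  · rintro ⟨hΘ, P, -, hP, h⟩
    exact ⟨hΘ, fun Ξ hΞ => QChan.mem_constantChannels_of_isNonSignalling hΘ hP h hΞ⟩
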